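/- **Setting.** Let $G=(V,E,w)$ be a finite connected weighted graph with edge weights at least $1$, $d_G$ its weighted distance, $D$ its diameter, $\rho>1$, $h=\lceil\log_\rho D\rceil$ and $r_i=\min\{D,\rho^i\}$ ($i\ge 0$). A strong sparse partition hierarchy with parameters $\sigma, I$ consists, for $0\le i\le h$, of a partition $P_i$ of $V$ into clusters such that every cluster $X$ has diameter at most $\sigma r_i$ in the induced subgraph $G[X]$ and every $r_i$-neighbourhood $\{x: d_G(u,x)\le r_i\}$ meets at most $I$ clusters; $P_h=\{V\}$, and level $-1$ consists of singletons. Each cluster $X$ has a leader $l(X)\in X$ and a spanning tree $T(X)$ that is a shortest path tree of $G[X]$ rooted at $l(X)$. The leader of $P_h$ is the root $r$. **Failures.** Let $e_1,\dots,e_f$ be distinct edges that fail in this order, leaving a connected graph $G'$ of diameter $D'$. Below level $h$ the clusters after the failures are the connected components of the trees $T(X)$ minus the failed edges; the leader of a component is its vertex closest to $l(X)$ on $T(X)$. After each failure the root has a shortest path tree in the current graph. Fix $\kappa\ge1$. If, after a failure, some vertex is farther than $\kappa\sigma\rho^{H}$ from $r$, where $H$ is the current top level, then the new top level $H'$ is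 the smallest integer such that $\sigma\rho^{H'}$ exceeds all distances to $r$; the levels $H,\dots,H'-1$ are obtained by cutting the failed edge in the root tree used before this failure (and are cut further by later failures), and level $H'$ is the single cluster $V$ with leader $r$. Let $h'$ be the top level after all $f$ failures, write $l_i(u)$ for the resulting level-$i$ leader of $u$ (with $l_{-1}(u)=u$), and $r'_i=\min\{D',\rho^i\}$. **Moves.** The directory path consists of the token owner $\phi_{-1}$ and, for $0\le i\le h'$, a node $\phi_i=l_i(w_i)$, where $w_i$ is the vertex whose operation put $\phi_i$ on the path. Initially (after the repair of the data structures) the owner and the $w_i$ are arbitrary. Sending a message from $x$ to $y$ costs $d_{G'}(x,y)$. A move issued by $u$ queries, for $i=0,1,\dots$, all leaders of level-$i$ clusters that meet $\{x:d_{G'}(u,x)\le r'_i\}$ until, at level $j$, one of them is $\phi_j$. On every level $i<j$ it notifies $l_i(u)$, links it with $l_{i-1}(u)$ in both directions and informs the special parent $l_{\min(i+s,h')}(u)$, where $s\ge 0$ is an integer (the value of $\log_\rho(c'\sigma)$, possibly rounded) with $\rho^s\le c'\sigma$ for a constant $c'>0$. It then links $\phi_j$ with $l_{j-1}(u)$ in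 both directions, follows the old path $\phi_j,\phi_{j-1},\dots,\phi_{-1}$ downward, deleting the old nodes below level $j$ and the information at their special parents, and transfers the token from $\phi_{-1}$ to $u$. The new path has owner $u$, has $l_i(u)$ at the levels $0\le i<j$ and is unchanged from level $j$ up. Let $S=s_1,\dots,s_q$ be a sequence of moves executed sequentially after the $f$-th failure and its repair, each issued by a vertex $v_m$ that does not own the token at that time; let $v_0$ be the owner before $S$. Let $C(S)$ be the total cost of $S$, let $C^*(S)=\sum_{m=1}^{q-1}d_{G'}(v_m,v_{m+1})$ be the optimal cost, and let $|S_i|$ be the number of moves of $S$ that search up to level $i$ or higher. Put $L=\max\{1,h'\}$. **Theorem.** For all constants $c'>0$, $\kappa\ge 1$ there are constants $K,N>0$, depending only on $c'$ and $\kappa$, such that in every such situation (with any $f\ge0$): 1. if $q\ge N L^2D'$, then $C(S)\le K\cdot L\,\sigma\rho\,((I+f)+\sigma)\cdot C^*(S)$; 2. for every $S$ (of any length), $C(S)\le h'D'+\sum_{m=1}^{q}d_{G'}(v_{m-1},v_m)+K\sum_{i=0}^{h'}|S_i|\,\sigma r'_i\,((I+f)+\sigma)$, that is, the links of the directory path stretched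 by the failures add at most $h'D'$ to the normal cost of the moves (the middle sum is the cost of the token transfers). -/

import Mathlib

noncomputable section

namespace FaultyDirectory

/-! ### Weighted graphs -/

/-- Total weight of a walk. -/
def walkWeight {V : Type*} (w : Sym2 V → ℝ) {G : SimpleGraph V} {u v : V} (p : G.Walk u v) : ℝ :=
  (p.edges.map w).sum

/-- Weighted distance: the length of a shortest walk
(used only between vertices that are joined by a walk). -/
def wdist {V : Type*} (G : SimpleGraph V) (w : Sym2 V → ℝ) (u v : V) : ℝ :=
  ⨅ p : G.Walk u v, walkWeight w p

/-- Weighted diameter. -/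
def wdiam {V : Type*} (G : SimpleGraph V) (w : Sym2 V → ℝ) : ℝ :=
  ⨆ p : V × V, wdist G w p.1 p.2

/-- The `r`-neighbourhood of `u`. -/
def wball {V : Type*} (G : SimpleGraph V) (w : Sym2 V → ℝ) (u : V) (r : ℝ) : Set V :=
  {x | wdist G w u x ≤ r}

/-! ### Strong sparse partitions

A partition together with a choice of a leader inside each cluster is the same thing as an
idempotent map `l : V → V` sending each vertex to the leader of its cluster: the clusters are the
fibres of `l`. -/

/-- The disjoint union of the induced subgraphs `G[X]` over all clusters `X` of `l`. -/
def clusterGraph {V : Type*} (G : SimpleGraph V) (l : V → V) : SimpleGraph V where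
  Adj x y := G.Adj x y ∧ l x = l y
  symm := ⟨fun _ _ h => ⟨h.1.symm, h.2.symm⟩⟩
  loopless := ⟨fun x h => G.loopless.irrefl x h.1⟩

/-- `(r, σ, I)`-strong sparse partition with leaders. -/
structure IsStrongSparsePartition {V : Type*} (G : SimpleGraph V) (w : Sym2 V → ℝ)
    (r σ : ℝ) (I : ℕ) (l : V → V) : Prop where
  /-- the leader of a cluster belongs to that cluster -/
  leader_mem : ∀ x, l (l x) = l x
  /-- every cluster `X` is connected in `G[X]` and has diameter at most `r σ` there -/
  strong_diam : ∀ x y, l x = l y →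
    (clusterGraph G l).Reachable x y ∧ wdist (clusterGraph G l) w x y ≤ r * σ
  /-- every `r`-neighbourhood meets at most `I` clusters -/
  sparse : ∀ u, (l '' wball G w u r).ncard ≤ I

/-- `p` is the parent map of spanning trees of the clusters of `l`, each of them a shortest path
tree of `G[X]` rooted at the leader of `X` (the root is its own parent). -/
structure IsShortestPathForest {V : Type*} (G : SimpleGraph V) (w : Sym2 V → ℝ)
    (l p : V → V) : Prop where
  root : ∀ x, l x = x → p x = x
  step : ∀ x, l x ≠ x → (clusterGraph G l).Adj x (p x) ∧
    wdist (clusterGraph G l) w (l x) x =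
      wdist (clusterGraph G l) w (l x) (p x) + w s(x, p x)

/-- Index `h = ⌈log_ρ D⌉` of the top level. -/
def height {V : Type*} (G : SimpleGraph V) (w : Sym2 V → ℝ) (ρ : ℝ) : ℕ :=
  ⌈Real.logb ρ (wdiam G w)⌉₊

/-- The level radii `r_i = min {D, ρ ^ i}`, `i ≥ 0`. -/
def rad {V : Type*} (G : SimpleGraph V) (w : Sym2 V → ℝ) (ρ : ℝ) (i : ℕ) : ℝ :=
  min (wdiam G w) (ρ ^ i)

/-- A strong sparse partition hierarchy (before any failure): levels `0, …, h`, with leaders and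
spanning trees. The level `-1` of singletons is left implicit. -/
structure Hierarchy {V : Type*} (G : SimpleGraph V) (w : Sym2 V → ℝ) (ρ σ : ℝ) (I : ℕ) where
  leader : ℕ → V → V
  parent : ℕ → V → V
  root : V
  sparse : ∀ i ≤ height G w ρ, IsStrongSparsePartition G w (rad G w ρ i) σ I (leader i)
  tree : ∀ i ≤ height G w ρ, IsShortestPathForest G w (leader i) (parent i)
  /-- the top level consists of a single cluster, led by the root -/
  top : ∀ x, leader (height G w ρ) x = root

/-! ### Edge failures and reclustering -/

/-- The graph that remains after the first `t` failures of the list `F`. -/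
def afterFailures {V : Type*} (G : SimpleGraph V) (F : List (Sym2 V)) (t : ℕ) : SimpleGraph V :=
  G.deleteEdges {e | e ∈ F.take t}

/-- Index of the top level after the first `t` failures. Layers are added when some vertex is
farther than `κ σ ρ ^ H` from the root, `H` being the current top level; the new top
level is then the smallest `k` such that `σ ρ ^ k` exceeds all distances to the root. -/
def topLevel {V : Type*} (G : SimpleGraph V) (w : Sym2 V → ℝ) (ρ σ κ : ℝ) (root : V)
    (F : List (Sym2 V)) : ℕ → ℕ
  | 0 => height G w ρ
  | t + 1 =>
    let R : ℝ := ⨆ x, wdist (afterFailures G F (t + 1)) w root x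
    let H : ℕ := topLevel G w ρ σ κ root F t
    open Classical in
    if R ≤ κ * σ * ρ ^ H then H else sInf {k : ℕ | R < σ * ρ ^ k}

/-- The trees stored for the root cluster: `T t` is a shortest path tree from the root in the
graph that remains after the first `t` failures, starting with the tree of the hierarchy. -/
structure IsRootTrees {V : Type*} {G : SimpleGraph V} {w : Sym2 V → ℝ} {ρ σ : ℝ} {I : ℕ}
    (P : Hierarchy G w ρ σ I) (F : List (Sym2 V)) (T : ℕ → V → V) : Prop where
  init : T 0 = P.parent (height G w ρ)
  spt : ∀ t ≤ F.length,
    IsShortestPathForest (afterFailures G F t) w (fun _ => P.root) (T t)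

/-- The spanning trees of level `i` before the failed edges are cut: below the original top level
these are the trees of the hierarchy. A level `i` with `H_t ≤ i < H_{t+1}` (`H_t` the top level
after `t` failures) is created by the failure number `t + 1` out of the root tree of that moment;
the final top level carries the final root tree. -/
def levelTrees {V : Type*} {G : SimpleGraph V} {w : Sym2 V → ℝ} {ρ σ : ℝ} {I : ℕ}
    (P : Hierarchy G w ρ σ I) (κ : ℝ) (F : List (Sym2 V)) (T : ℕ → V → V) (i : ℕ) : V → V :=
  if i < height G w ρ then P.parent i
  else T (Nat.findGreatest (fun t => topLevel G w ρ σ κ P.root F t ≤ i) F.length)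

/-- Go to the parent unless the edge to it has failed. -/
def cutParent {V : Type*} (F : List (Sym2 V)) (p : V → V) (x : V) : V :=
  open Classical in if s(x, p x) ∈ F then x else p x

/-- The leader of the cluster of `x` after reclustering. The new clusters are the connected
components of the spanning trees minus the failed edges, and the leader of a component is its
vertex closest to the old leader, i.e. the last vertex reached from `x` by following
surviving parent edges. -/
def cutLeader {V : Type*} [Fintype V] (F : List (Sym2 V)) (p : V → V) (x : V) : V :=
  (cutParent F p)^[Fintype.card V] x

/-! ### The directory protocol -/

/-- The static data on which the protocol runs: network, locality parameter, leaders of the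
levels `0, …, top`, and the level offset of special parents. -/
structure Overlay (V : Type*) where
  graph : SimpleGraph V
  weight : Sym2 V → ℝ
  rho : ℝ
  top : ℕ
  leader : ℕ → V → V
  offset : ℕ

/-- The repaired overlay after all failures of `F`. -/
def repaired {V : Type*} [Fintype V] {G : SimpleGraph V} {w : Sym2 V → ℝ} {ρ σ : ℝ} {I : ℕ}
    (P : Hierarchy G w ρ σ I) (κ : ℝ) (F : List (Sym2 V)) (T : ℕ → V → V) (s : ℕ) :
    Overlay V where
  graph := afterFailures G F F.length
  weight := w
  rho := ρ
  top := topLevel G w ρ σ κ P.root F F.length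
  leader i := cutLeader F (levelTrees P κ F T i)
  offset := s

/-- State of the directory path: the token owner `φ_{-1}`, and for every level `i ≥ 0` the vertex
`w` whose operation put `φ_i` on the path, so that `φ_i` is the level-`i` leader of `w`. -/
structure PathState (V : Type*) where
  owner : V
  writer : ℕ → V

namespace Overlay

variable {V : Type*} (O : Overlay V)

/-- Cost of sending a message. -/
def dist (u v : V) : ℝ := wdist O.graph O.weight u v

/-- Diameter of the network. -/
def diam : ℝ := wdiam O.graph O.weight

/-- Level radius `r_i` in the network. -/
def radius (i : ℕ) : ℝ := rad O.graph O.weight O.rho i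

/-- The directory path node `φ_i`. -/
def node (d : PathState V) (i : ℕ) : V := O.leader i (d.writer i)

/-- The directory path node `φ_{i-1}`, one level below `i`. -/
def nodeBelow (d : PathState V) : ℕ → V
  | 0 => d.owner
  | i + 1 => O.node d i

/-- The leader `l_{i-1}(u)`, one level below `i`. -/
def leaderBelow (u : V) : ℕ → V
  | 0 => u
  | i + 1 => O.leader i u

/-- The special parent with respect to level `i` for the vertex `u`. -/
def specialParent (i : ℕ) (u : V) : V := O.leader (min (i + O.offset) O.top) u

/-- The leaders of the level-`i` clusters that meet the `r_i`-neighbourhood of `u`. -/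
def contacted [Fintype V] (i : ℕ) (u : V) : Finset V :=
  open Classical in (Finset.univ.filter fun x => O.dist u x ≤ O.radius i).image (O.leader i)

/-- The lowest level at which a move of `u` discovers the directory path. -/
def foundLevel [Fintype V] (d : PathState V) (u : V) : ℕ :=
  sInf {i | O.node d i ∈ O.contacted i u}

/-- Effect of a move of `u`: the path is replaced below the level at which it was discovered. -/
def move [Fintype V] (d : PathState V) (u : V) : PathState V where
  owner := u
  writer i := if i < O.foundLevel d u then u else d.writer i

/-- Upward phase: query (with answer) the contacted leaders at every level up to `j`, the level
of discovery; on the levels below `j`, notify the own leader, set the two links to the level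
below, and inform the special parent; finally link `φ_j` and the new node below it. -/
def upCost [Fintype V] (d : PathState V) (u : V) : ℝ :=
  let j := O.foundLevel d u
  (∑ i ∈ Finset.range (j + 1), ∑ m ∈ O.contacted i u, 2 * O.dist u m) +
  (∑ i ∈ Finset.range j, (O.dist u (O.leader i u) +
    2 * O.dist (O.leader i u) (O.leaderBelow u i) +
    O.dist (O.leader i u) (O.specialParent i u))) +
  2 * O.dist (O.node d j) (O.leaderBelow u j)

/-- Downward phase: follow the old path from `φ_j` to the old owner, and delete the
information at the special parents of the removed nodes. -/
def downCost [Fintype V] (d : PathState V) (u : V) : ℝ :=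
  let j := O.foundLevel d u
  (∑ k ∈ Finset.range (j + 1), O.dist (O.node d k) (O.nodeBelow d k)) +
  ∑ k ∈ Finset.range j, O.dist (O.node d k) (O.specialParent k (d.writer k))

/-- Cost of a move: both phases and the transfer of the token to its new owner. -/
def moveCost [Fintype V] (d : PathState V) (u : V) : ℝ :=
  O.upCost d u + O.downCost d u + O.dist d.owner u

/-- Total cost of a sequence of sequentially executed moves. -/
def totalCost [Fintype V] : PathState V → List V → ℝ
  | _, [] => 0
  | d, u :: S => O.moveCost d u + totalCost (O.move d u) S

/-- The number `|S_i|` of moves in the sequence whose upward phase reaches level `i`. -/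
def reachCount [Fintype V] (i : ℕ) : PathState V → List V → ℕ
  | _, [] => 0
  | d, u :: S => (if i ≤ O.foundLevel d u then 1 else 0) + reachCount i (O.move d u) S

/-- Optimal cost of handing the token on along a sequence of vertices:
the sum of the distances of consecutive vertices. -/
def optCost : List V → ℝ
  | [] => 0
  | [_] => 0
  | u :: v :: S => O.dist u v + optCost (v :: S)

end Overlay

end FaultyDirectory

end

/-!
The cost analysis separates the geometry of the repaired hierarchy from the protocol.

Geometry. Every level is obtained by cutting the failed edges in a shortest path forest of an
intermediate graph. A surviving path towards the leader is a piece of a shortest path, so its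
length is at most the depth of the forest (`wdist_cutLeader_le`). Below the original height this
depth is at most `σ r_i` by the strong diameter. For a level built from a root tree, the rule that
adds layers keeps all distances to the root below `κ σ ρ ^ i` (`topLevel_spec`). Each failed edge
splits at most one tree of a level, so a neighbourhood meets at most `I + f` new clusters
(`ncard_cutLeader_image_le`). Failures only increase distances, so neighbourhoods shrink and the
diameter grows. These facts are collected in `Overlay.IsSparseCover`.

Protocol. All links that a move creates at level `k` have length `O(κ σ r_k)`. The initial path
may contain longer links; the sum of their excess lengths is the potential `Overlay.stretch`. A
move that traverses such a link removes its excess for good (`stretch_move`), and the link to the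
top level has none because all vertices are close to the root, whence the additive term
`O.top * O.diam`.

For the comparison with the optimal cost: a move that searches up to level `i + 1` has not found
the path at level `i`, so it is farther than `r_i` from the last move that searched that far.
Hence `r_i |S_{i+1}|` is at most the optimal cost plus the distance to the initial writer
(`radius_mul_reachCount_le`). Since consecutive moves have distance at least `1`, in a long
sequence the optimal cost exceeds the diameter, and with it all additive terms.
-/

namespace FaultyDirectory

/-! ### Weighted distances -/

section Distance

variable {V : Type*} {G H : SimpleGraph V} {w : Sym2 V → ℝ}

lemma walkWeight_nonneg (hw : ∀ e ∈ G.edgeSet, 1 ≤ w e) {u v : V} (p : G.Walk u v) :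
    0 ≤ walkWeight w p := by
  refine List.sum_nonneg fun a ha => ?_
  obtain ⟨e, he, rfl⟩ := List.mem_map.1 ha
  exact zero_le_one.trans (hw e (p.edges_subset_edgeSet he))

lemma wdist_le_walkWeight (hw : ∀ e ∈ G.edgeSet, 1 ≤ w e) {u v : V} (p : G.Walk u v) :
    wdist G w u v ≤ walkWeight w p :=
  ciInf_le ⟨0, by rintro _ ⟨q, rfl⟩; exact walkWeight_nonneg hw q⟩ p

lemma wdist_nonneg (hw : ∀ e ∈ G.edgeSet, 1 ≤ w e) (u v : V) : 0 ≤ wdist G w u v :=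
  Real.iInf_nonneg fun p => walkWeight_nonneg hw p

lemma wdist_self (hw : ∀ e ∈ G.edgeSet, 1 ≤ w e) (u : V) : wdist G w u u = 0 :=
  le_antisymm ((wdist_le_walkWeight hw SimpleGraph.Walk.nil).trans_eq (by simp [walkWeight]))
    (wdist_nonneg hw u u)

lemma wdist_comm (u v : V) : wdist G w u v = wdist G w v u :=
  Function.Surjective.iInf_congr SimpleGraph.Walk.reverse
    (fun p => ⟨p.reverse, p.reverse_reverse⟩) fun p => by simp [walkWeight, List.sum_reverse]

lemma wdist_triangle (hw : ∀ e ∈ G.edgeSet, 1 ≤ w e) (hG : G.Connected) (x y z : V) :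
    wdist G w x z ≤ wdist G w x y + wdist G w y z := by
  have : Nonempty (G.Walk x y) := hG.preconnected x y
  have : Nonempty (G.Walk y z) := hG.preconnected y z
  refine le_ciInf_add_ciInf fun p q => (wdist_le_walkWeight hw (p.append q)).trans_eq ?_
  simp [walkWeight]

lemma wdist_anti (hw : ∀ e ∈ G.edgeSet, 1 ≤ w e) (hHG : H ≤ G) {u v : V}
    (h : H.Reachable u v) : wdist G w u v ≤ wdist H w u v := by
  have : Nonempty (H.Walk u v) := h
  refine le_ciInf fun p => (wdist_le_walkWeight hw (p.mapLe hHG)).trans_eq ?_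
  simp [walkWeight]

lemma wdist_le_of_adj (hw : ∀ e ∈ G.edgeSet, 1 ≤ w e) {u v : V} (h : G.Adj u v) :
    wdist G w u v ≤ w s(u, v) :=
  (wdist_le_walkWeight hw h.toWalk).trans_eq (by simp [walkWeight])

lemma one_le_wdist (hw : ∀ e ∈ G.edgeSet, 1 ≤ w e) {u v : V} (h : G.Reachable u v)
    (huv : u ≠ v) : 1 ≤ wdist G w u v := by
  have : Nonempty (G.Walk u v) := h
  refine le_ciInf fun p => ?_
  cases p with
  | nil => exact absurd rfl huv
  | cons e q =>
    have h1 := hw _ (G.mem_edgeSet.2 e)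
    have h2 := walkWeight_nonneg hw q
    simp only [walkWeight, SimpleGraph.Walk.edges_cons, List.map_cons, List.sum_cons] at h2 ⊢
    linarith

lemma wdist_le_wdiam [Finite V] (u v : V) : wdist G w u v ≤ wdiam G w :=
  le_ciSup (f := fun p : V × V => wdist G w p.1 p.2) (Set.finite_range _).bddAbove (u, v)

lemma wdiam_nonneg (hw : ∀ e ∈ G.edgeSet, 1 ≤ w e) : 0 ≤ wdiam G w :=
  Real.iSup_nonneg fun p => wdist_nonneg hw p.1 p.2

lemma wdiam_anti [Finite V] (hw : ∀ e ∈ G.edgeSet, 1 ≤ w e) (hHG : H ≤ G)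
    (hH : H.Connected) : wdiam G w ≤ wdiam H w := by
  have := hH.nonempty
  exact ciSup_le fun p =>
    (wdist_anti hw hHG (hH.preconnected p.1 p.2)).trans (wdist_le_wdiam p.1 p.2)

lemma clusterGraph_le (l : V → V) : clusterGraph G l ≤ G := fun _ _ h => h.1

lemma clusterGraph_const (r : V) : clusterGraph G (fun _ => r) = G := by
  ext x y
  simp [clusterGraph]

lemma edge_weight_of_le (hw : ∀ e ∈ G.edgeSet, 1 ≤ w e) (hHG : H ≤ G) :
    ∀ e ∈ H.edgeSet, 1 ≤ w e :=
  fun e he => hw e (SimpleGraph.edgeSet_mono hHG he)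

end Distance

/-! ### Cutting failed edges in shortest path forests -/

section Cut

variable {V : Type*} {G : SimpleGraph V} {w : Sym2 V → ℝ} {l p : V → V}

/-- The depth of `x` in its tree. -/
noncomputable def depth (G : SimpleGraph V) (w : Sym2 V → ℝ) (l : V → V) (x : V) : ℝ :=
  wdist (clusterGraph G l) w (l x) x

lemma depth_nonneg (hw : ∀ e ∈ G.edgeSet, 1 ≤ w e) (l : V → V) (x : V) : 0 ≤ depth G w l x :=
  wdist_nonneg (edge_weight_of_le hw (clusterGraph_le l)) _ _

lemma IsShortestPathForest.leader_parent (h : IsShortestPathForest G w l p) (x : V) :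
    l (p x) = l x := by
  by_cases hx : l x = x
  · rw [h.root x hx]
  · exact (h.step x hx).1.2.symm

lemma IsShortestPathForest.depth_eq (h : IsShortestPathForest G w l p) {x : V} (hx : l x ≠ x) :
    depth G w l x = depth G w l (p x) + w s(x, p x) := by
  rw [depth, depth, h.leader_parent, (h.step x hx).2]

lemma IsShortestPathForest.depth_parent_lt (hw : ∀ e ∈ G.edgeSet, 1 ≤ w e)
    (h : IsShortestPathForest G w l p) {x : V} (hx : l x ≠ x) :
    depth G w l (p x) < depth G w l x := by
  have := hw _ (G.mem_edgeSet.2 (h.step x hx).1.1)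
  rw [h.depth_eq hx]
  linarith

lemma leader_cutParent (h : IsShortestPathForest G w l p) (F : List (Sym2 V)) (x : V) :
    l (cutParent F p x) = l x := by
  unfold cutParent
  split_ifs
  · rfl
  · exact h.leader_parent x

lemma leader_cutParent_iterate (h : IsShortestPathForest G w l p) (F : List (Sym2 V)) (n : ℕ)
    (x : V) : l ((cutParent F p)^[n] x) = l x := by
  induction n with
  | zero => rfl
  | succ n ih => rw [Function.iterate_succ_apply', leader_cutParent h, ih]

lemma depth_cutParent_lt (hw : ∀ e ∈ G.edgeSet, 1 ≤ w e) (h : IsShortestPathForest G w l p)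
    (F : List (Sym2 V)) {x : V} (hx : cutParent F p x ≠ x) :
    depth G w l (cutParent F p x) < depth G w l x := by
  unfold cutParent at hx ⊢
  split_ifs at hx ⊢ with hF
  · exact absurd rfl hx
  · exact h.depth_parent_lt hw fun hl => hx (h.root x hl)

/-- The depth strictly decreases along surviving parent edges, so `|V|` steps suffice to reach
a vertex whose parent edge is missing. -/
lemma cutParent_cutLeader [Fintype V] (hw : ∀ e ∈ G.edgeSet, 1 ≤ w e)
    (h : IsShortestPathForest G w l p) (F : List (Sym2 V)) (x : V) :
    cutParent F p (cutLeader F p x) = cutLeader F p x := by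
  by_contra hne
  have hmove : ∀ n ≤ Fintype.card V,
      cutParent F p ((cutParent F p)^[n] x) ≠ (cutParent F p)^[n] x := by
    intro n hn hfix
    apply hne
    obtain ⟨k, hk⟩ := Nat.exists_eq_add_of_le' hn
    rw [cutLeader, hk, Function.iterate_add_apply, Function.iterate_fixed hfix, hfix]
  have hanti : StrictAnti fun n : Fin (Fintype.card V + 1) =>
      depth G w l ((cutParent F p)^[(n : ℕ)] x) := by
    refine Fin.strictAnti_iff_succ_lt.2 fun n => ?_
    simp only [Fin.val_succ, Fin.val_castSucc, Function.iterate_succ_apply']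
    exact depth_cutParent_lt hw h F (hmove n n.2.le)
  have hinj : Function.Injective fun n : Fin (Fintype.card V + 1) =>
      (cutParent F p)^[(n : ℕ)] x :=
    fun a b hab => hanti.injective (congrArg (depth G w l) hab)
  simpa using Fintype.card_le_of_injective _ hinj

/-- Surviving tree paths are descending pieces of shortest paths, so they are not longer than
the depth of their upper end. -/
lemma wdist_cutLeader_le [Fintype V] {G' : SimpleGraph V} (hw : ∀ e ∈ G.edgeSet, 1 ≤ w e)
    (hG'G : G' ≤ G) (hG' : G'.Connected) (h : IsShortestPathForest G w l p) {F : List (Sym2 V)}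
    (hF : ∀ x y, G.Adj x y → s(x, y) ∉ F → G'.Adj x y) (x : V) :
    wdist G' w x (cutLeader F p x) ≤ depth G w l x := by
  have hw' := edge_weight_of_le hw hG'G
  have key : ∀ n, wdist G' w x ((cutParent F p)^[n] x) +
      depth G w l ((cutParent F p)^[n] x) ≤ depth G w l x := by
    intro n
    induction n with
    | zero => simp [wdist_self hw']
    | succ n ih =>
      rw [Function.iterate_succ_apply']
      set y := (cutParent F p)^[n] x
      by_cases hy : s(y, p y) ∈ F
      · simpa [cutParent, hy] using ih
      by_cases hl : l y = y
      · simpa [cutParent, h.root y hl] using ih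
      have hadj := hF _ _ (h.step y hl).1.1 hy
      have h1 := wdist_le_of_adj hw' hadj
      have h2 := wdist_triangle hw' hG' x y (p y)
      have h3 := h.depth_eq hl
      simp only [cutParent, hy, if_false]
      linarith
  have h1 := key (Fintype.card V)
  have h2 := depth_nonneg hw l ((cutParent F p)^[Fintype.card V] x)
  unfold cutLeader
  linarith

/-- Each failed edge splits at most one tree into two. The leader of a new cluster is either an
old leader or the lower end of a failed tree edge, and it is determined by that edge. -/
lemma ncard_cutLeader_image_le [Fintype V] (hw : ∀ e ∈ G.edgeSet, 1 ≤ w e)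
    (h : IsShortestPathForest G w l p) (F : List (Sym2 V)) (B : Set V) :
    (cutLeader F p '' B).ncard ≤ (l '' B).ncard + F.length := by
  classical
  set E : Set V := {y | l y ≠ y ∧ s(y, p y) ∈ F}
  have hsub : cutLeader F p '' B ⊆ l '' B ∪ E := by
    rintro _ ⟨x, hx, rfl⟩
    set y := cutLeader F p x with hy
    have hfix : cutParent F p y = y := cutParent_cutLeader hw h F x
    by_cases hl : l y = y
    · exact Or.inl ⟨x, hx, by rw [← hl, hy, cutLeader, leader_cutParent_iterate h]⟩
    · refine Or.inr ⟨hl, by_contra fun hF => ?_⟩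
      rw [cutParent, if_neg hF] at hfix
      exact (h.step y hl).1.1.ne hfix.symm
  have hE : E.ncard ≤ F.length := by
    have hinj : Set.InjOn (fun y => s(y, p y)) E := by
      intro y hy z hz hyz
      rcases Sym2.eq_iff.1 hyz with ⟨h1, -⟩ | ⟨h1, h2⟩
      · exact h1
      · have h3 := h.depth_parent_lt hw hy.1
        have h4 := h.depth_parent_lt hw hz.1
        rw [h2] at h3
        rw [← h1] at h4
        exact absurd h3 h4.asymm
    calc E.ncard ≤ (F.toFinset : Set (Sym2 V)).ncard :=
          Set.ncard_le_ncard_of_injOn _ (fun y hy => by simpa using hy.2) hinj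
      _ ≤ F.length := by
          rw [Set.ncard_coe_finset]
          exact F.toFinset_card_le
  calc _ ≤ (l '' B ∪ E).ncard := Set.ncard_le_ncard hsub
    _ ≤ (l '' B).ncard + E.ncard := Set.ncard_union_le _ _
    _ ≤ _ := by omega

end Cut

/-! ### The repaired hierarchy -/

section Repair

variable {V : Type*} {G : SimpleGraph V} {w : Sym2 V → ℝ} {ρ σ κ : ℝ}
  {I : ℕ} {F : List (Sym2 V)}

lemma afterFailures_le (t : ℕ) : afterFailures G F t ≤ G := G.deleteEdges_le _

lemma afterFailures_length_le (t : ℕ) :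
    afterFailures G F F.length ≤ afterFailures G F t := by
  refine SimpleGraph.deleteEdges_anti fun e he => ?_
  rw [Set.mem_ofPred_eq, List.take_length]
  exact List.mem_of_mem_take he

lemma afterFailures_zero : afterFailures G F 0 = G := by
  simp [afterFailures]

lemma afterFailures_length_adj {x y : V} :
    (afterFailures G F F.length).Adj x y ↔ G.Adj x y ∧ s(x, y) ∉ F := by
  simp [afterFailures, SimpleGraph.deleteEdges_adj]

/-- If layers are added, the old top level `H` violates the distance bound with the factor `κ`
while the new one satisfies it even without this factor; since `κ ≥ 1`, the new level is higher. -/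
lemma topLevel_spec [Fintype V] (hρ : 1 < ρ) (hσ : 0 < σ) (hκ : 1 ≤ κ)
    (root : V) (t : ℕ) :
    topLevel G w ρ σ κ root F t ≤ topLevel G w ρ σ κ root F (t + 1) ∧
      ∀ x, wdist (afterFailures G F (t + 1)) w root x ≤
        κ * σ * ρ ^ topLevel G w ρ σ κ root F (t + 1) := by
  have hR : ∀ x, wdist (afterFailures G F (t + 1)) w root x ≤
      ⨆ x, wdist (afterFailures G F (t + 1)) w root x :=
    fun x => le_ciSup (f := fun x => wdist (afterFailures G F (t + 1)) w root x)
      (Set.finite_range _).bddAbove x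
  set R := ⨆ x, wdist (afterFailures G F (t + 1)) w root x with hRdef
  set H := topLevel G w ρ σ κ root F t with hH
  have hunfold : topLevel G w ρ σ κ root F (t + 1) =
      if R ≤ κ * σ * ρ ^ H then H else sInf {k : ℕ | R < σ * ρ ^ k} := by
    rw [topLevel]
  rw [hunfold]
  split_ifs with hle
  · exact ⟨le_rfl, fun x => (hR x).trans hle⟩
  · have hne : {k : ℕ | R < σ * ρ ^ k}.Nonempty := by
      obtain ⟨k, hk⟩ := pow_unbounded_of_one_lt (R / σ) hρ
      exact ⟨k, by rwa [div_lt_iff₀' hσ] at hk⟩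
    have hmem : R < σ * ρ ^ sInf {k : ℕ | R < σ * ρ ^ k} := Nat.sInf_mem hne
    set k := sInf {k : ℕ | R < σ * ρ ^ k}
    have hpos : ∀ n : ℕ, 0 < σ * ρ ^ n := fun n => by positivity
    have hκk : ∀ n : ℕ, σ * ρ ^ n ≤ κ * σ * ρ ^ n := fun n => by
      nlinarith [hpos n]
    refine ⟨?_, fun x => (hR x).trans (hmem.le.trans (hκk k))⟩
    have h1 : σ * ρ ^ H < σ * ρ ^ k := (hκk H).trans_lt ((not_le.1 hle).trans hmem)
    exact ((pow_lt_pow_iff_right₀ hρ).1 (lt_of_mul_lt_mul_left h1 hσ.le)).le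

lemma height_le_topLevel [Fintype V] (hρ : 1 < ρ) (hσ : 0 < σ) (hκ : 1 ≤ κ)
    (root : V) (t : ℕ) : height G w ρ ≤ topLevel G w ρ σ κ root F t := by
  induction t with
  | zero => exact le_rfl
  | succ t ih => exact ih.trans (topLevel_spec hρ hσ hκ root t).1

lemma Hierarchy.wdist_le (P : Hierarchy G w ρ σ I) (hw : ∀ e ∈ G.edgeSet, 1 ≤ w e) (x y : V) :
    wdist G w x y ≤ rad G w ρ (height G w ρ) * σ := by
  obtain ⟨h1, h2⟩ := (P.sparse _ le_rfl).strong_diam x y (by rw [P.top, P.top])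
  exact (wdist_anti hw (clusterGraph_le _) h1).trans h2

lemma wdist_root_le [Fintype V] (P : Hierarchy G w ρ σ I) (hw : ∀ e ∈ G.edgeSet, 1 ≤ w e)
    (hρ : 1 < ρ) (hσ : 0 < σ) (hκ : 1 ≤ κ) (t : ℕ) (x : V) :
    wdist (afterFailures G F t) w P.root x ≤
      κ * σ * ρ ^ topLevel G w ρ σ κ P.root F t := by
  cases t with
  | zero =>
    rw [afterFailures_zero]
    refine (P.wdist_le hw _ _).trans ?_
    rw [topLevel, mul_assoc]
    have h1 : rad G w ρ (height G w ρ) ≤ ρ ^ height G w ρ := min_le_right _ _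
    have h2 : 0 < σ * ρ ^ height G w ρ := by positivity
    nlinarith
  | succ t => exact (topLevel_spec hρ hσ hκ P.root t).2 x

lemma rad_nonneg (hw : ∀ e ∈ G.edgeSet, 1 ≤ w e) (hρ : 1 < ρ) (i : ℕ) : 0 ≤ rad G w ρ i :=
  le_min (wdiam_nonneg hw) (by positivity)

lemma rad_add_le (hw : ∀ e ∈ G.edgeSet, 1 ≤ w e) (hρ : 1 < ρ) (i k : ℕ) :
    rad G w ρ (i + k) ≤ ρ ^ k * rad G w ρ i := by
  have h1 : 1 ≤ ρ ^ k := one_le_pow₀ hρ.le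
  have h2 := wdiam_nonneg hw
  rw [rad, rad, mul_min_of_nonneg _ _ (zero_le_one.trans h1), ← pow_add, add_comm i k]
  exact min_le_min_right _ (by nlinarith)

/-- Two vertices at a positive distance force the diameter bound `σ D` of the top cluster to
be at least `D`. -/
lemma Hierarchy.one_le_stretch [Fintype V] [Nontrivial V] (P : Hierarchy G w ρ σ I)
    (hw : ∀ e ∈ G.edgeSet, 1 ≤ w e) (hG : G.Connected) (hσ : 0 < σ) : 1 ≤ σ := by
  have h1 : wdiam G w ≤ wdiam G w * σ :=
    ciSup_le fun p => (P.wdist_le hw p.1 p.2).trans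
      (mul_le_mul_of_nonneg_right (min_le_left _ _) hσ.le)
  obtain ⟨x, y, hxy⟩ := exists_pair_ne V
  have h2 := (one_le_wdist hw (hG.preconnected x y) hxy).trans (wdist_le_wdiam x y)
  nlinarith

lemma Hierarchy.one_le_sparsity [Fintype V] (P : Hierarchy G w ρ σ I)
    (hw : ∀ e ∈ G.edgeSet, 1 ≤ w e) (hρ : 1 < ρ) : 1 ≤ I := by
  refine le_trans ?_ ((P.sparse 0 (Nat.zero_le _)).sparse P.root)
  rw [Nat.one_le_iff_ne_zero, Ne, Set.ncard_eq_zero, Set.image_eq_empty]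
  refine Set.Nonempty.ne_empty ⟨P.root, ?_⟩
  rw [wball, Set.mem_ofPred_eq, wdist_self hw]
  exact rad_nonneg hw hρ 0

/-- A level above the original height is cut from a root tree that was current when the top level
was at most `i`, so that the distance bound of that moment applies at level `i`. -/
lemma levelTrees_of_height_le (P : Hierarchy G w ρ σ I) {T : ℕ → V → V} {i : ℕ}
    (hi : height G w ρ ≤ i) :
    ∃ t ≤ F.length, topLevel G w ρ σ κ P.root F t ≤ i ∧
      levelTrees P κ F T i = T t := by
  rw [levelTrees, if_neg (not_lt.2 hi)]
  exact ⟨_, Nat.findGreatest_le _,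
    Nat.findGreatest_spec (P := fun t => topLevel G w ρ σ κ P.root F t ≤ i)
      (Nat.zero_le F.length) hi, rfl⟩

end Repair

end FaultyDirectory
namespace FaultyDirectory

/-! ### Amortized analysis of the directory protocol -/

/-- The properties of an overlay on which the analysis of the protocol rests. Distances form a
metric with minimum distance `1`, a vertex and its level-`i` leader have distance at most
`a r_i`, a query phase contacts at most `M` leaders per level, and the top level is one cluster. -/
structure Overlay.IsSparseCover {V : Type*} [Fintype V] (O : Overlay V) (a : ℝ) (M : ℕ) :
    Prop where
  dist_self : ∀ x, O.dist x x = 0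
  dist_comm : ∀ x y, O.dist x y = O.dist y x
  dist_triangle : ∀ x y z, O.dist x z ≤ O.dist x y + O.dist y z
  one_le_dist : ∀ x y, x ≠ y → 1 ≤ O.dist x y
  dist_le_diam : ∀ x y, O.dist x y ≤ O.diam
  diam_nonneg : 0 ≤ O.diam
  one_lt_rho : 1 < O.rho
  radius_nonneg : ∀ i, 0 ≤ O.radius i
  radius_add_le : ∀ i k, O.radius (i + k) ≤ O.rho ^ k * O.radius i
  one_le_scale : 1 ≤ a
  dist_leader_le : ∀ i ≤ O.top, ∀ x, O.dist x (O.leader i x) ≤ a * O.radius i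
  card_contacted_le : ∀ i ≤ O.top, ∀ u, (O.contacted i u).card ≤ M
  leader_top : ∀ x y, O.leader O.top x = O.leader O.top y

namespace Overlay

variable {V : Type*} [Fintype V] {O : Overlay V} {a : ℝ} {M : ℕ}

lemma radius_mono (hO : O.IsSparseCover a M) {i k : ℕ} (h : i ≤ k) :
    O.radius i ≤ O.radius k :=
  min_le_min_left _ (pow_le_pow_right₀ hO.one_lt_rho.le h)

lemma IsSparseCover.dist_nonneg (hO : O.IsSparseCover a M) (x y : V) : 0 ≤ O.dist x y := by
  by_cases h : x = y
  · rw [h, hO.dist_self]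
  · exact zero_le_one.trans (hO.one_le_dist x y h)

lemma leader_mem_contacted {i : ℕ} {u x : V} (h : O.dist u x ≤ O.radius i) :
    O.leader i x ∈ O.contacted i u := by
  classical
  simp only [contacted, Finset.mem_image, Finset.mem_filter, Finset.mem_univ, true_and]
  exact ⟨x, h, rfl⟩

lemma dist_contacted_le (hO : O.IsSparseCover a M) {i : ℕ} (hi : i ≤ O.top) {u m : V}
    (h : m ∈ O.contacted i u) : O.dist u m ≤ 2 * a * O.radius i := by
  classical
  simp only [contacted, Finset.mem_image, Finset.mem_filter, Finset.mem_univ, true_and] at h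
  obtain ⟨x, hx, rfl⟩ := h
  have h1 := hO.dist_triangle u x (O.leader i x)
  have h2 := hO.dist_leader_le i hi x
  have h3 := mul_le_mul_of_nonneg_right hO.one_le_scale (hO.radius_nonneg i)
  linarith

lemma top_mem_found (hO : O.IsSparseCover a M) (d : PathState V) (u : V) :
    O.node d O.top ∈ O.contacted O.top u := by
  rw [node, hO.leader_top _ u]
  exact leader_mem_contacted (by rw [hO.dist_self]; exact hO.radius_nonneg _)

lemma foundLevel_le_top (hO : O.IsSparseCover a M) (d : PathState V) (u : V) :
    O.foundLevel d u ≤ O.top :=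
  Nat.sInf_le (top_mem_found hO d u)

lemma node_foundLevel_mem (hO : O.IsSparseCover a M) (d : PathState V) (u : V) :
    O.node d (O.foundLevel d u) ∈ O.contacted (O.foundLevel d u) u :=
  Nat.sInf_mem (s := {i | O.node d i ∈ O.contacted i u}) ⟨_, top_mem_found hO d u⟩

lemma radius_lt_of_lt_foundLevel {d : PathState V} {u : V} {i : ℕ}
    (h : i < O.foundLevel d u) : O.radius i < O.dist u (d.writer i) := by
  by_contra! hle
  exact Nat.notMem_of_lt_sInf h (leader_mem_contacted hle)

lemma dist_leaderBelow_le (hO : O.IsSparseCover a M) {i : ℕ} (hi : i ≤ O.top) (u : V) :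
    O.dist u (O.leaderBelow u i) ≤ a * O.radius i := by
  have ha := zero_le_one.trans hO.one_le_scale
  cases i with
  | zero =>
    rw [leaderBelow, hO.dist_self]
    exact mul_nonneg ha (hO.radius_nonneg _)
  | succ i =>
    exact (hO.dist_leader_le i (by omega) u).trans
      (mul_le_mul_of_nonneg_left (radius_mono hO i.le_succ) ha)

lemma dist_leader_leaderBelow_le (hO : O.IsSparseCover a M) {i : ℕ} (hi : i ≤ O.top) (u : V) :
    O.dist (O.leader i u) (O.leaderBelow u i) ≤ 2 * a * O.radius i := by
  have h1 := hO.dist_triangle (O.leader i u) u (O.leaderBelow u i)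
  have h2 := hO.dist_leader_le i hi u
  have h3 := dist_leaderBelow_le hO hi u
  rw [hO.dist_comm] at h2
  linarith

lemma dist_specialParent_le (hO : O.IsSparseCover a M) {b : ℝ} (hb : O.rho ^ O.offset ≤ b)
    {i : ℕ} (hi : i ≤ O.top) (u : V) :
    O.dist (O.leader i u) (O.specialParent i u) ≤ a * O.radius i * (1 + b) := by
  have ha := zero_le_one.trans hO.one_le_scale
  have h1 := hO.dist_triangle (O.leader i u) u (O.specialParent i u)
  have h2 := hO.dist_leader_le i hi u
  have h3 : O.dist u (O.specialParent i u) ≤ a * O.radius (min (i + O.offset) O.top) :=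
    hO.dist_leader_le _ (min_le_right _ _) u
  have h4 : O.radius (min (i + O.offset) O.top) ≤ b * O.radius i :=
    ((radius_mono hO (min_le_left _ _)).trans (hO.radius_add_le _ _)).trans
      (mul_le_mul_of_nonneg_right hb (hO.radius_nonneg i))
  have h5 := mul_le_mul_of_nonneg_left h4 ha
  rw [hO.dist_comm] at h2
  linarith

lemma dist_node_leaderBelow_le (hO : O.IsSparseCover a M) (d : PathState V) (u : V) :
    O.dist (O.node d (O.foundLevel d u)) (O.leaderBelow u (O.foundLevel d u)) ≤
      3 * a * O.radius (O.foundLevel d u) := by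
  have hj := foundLevel_le_top hO d u
  have h1 := hO.dist_triangle (O.node d (O.foundLevel d u)) u
    (O.leaderBelow u (O.foundLevel d u))
  have h2 := dist_contacted_le hO hj (node_foundLevel_mem hO d u)
  have h3 := dist_leaderBelow_le hO hj u
  rw [hO.dist_comm] at h2
  linarith

lemma upCost_le (hO : O.IsSparseCover a M) {b : ℝ} (hb : O.rho ^ O.offset ≤ b)
    (d : PathState V) (u : V) :
    O.upCost d u ≤ ∑ i ∈ Finset.range (O.foundLevel d u + 1),
      a * O.radius i * (4 * M + 12 + b) := by
  have ha := zero_le_one.trans hO.one_le_scale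
  have hj := foundLevel_le_top hO d u
  have hb0 : 0 ≤ b := (pow_nonneg (zero_le_one.trans hO.one_lt_rho.le) _).trans hb
  have hlink := dist_node_leaderBelow_le hO d u
  unfold upCost
  set j := O.foundLevel d u
  have hr : ∀ i, 0 ≤ a * O.radius i := fun i => mul_nonneg ha (hO.radius_nonneg i)
  have hquery : ∑ i ∈ Finset.range (j + 1), ∑ m ∈ O.contacted i u, 2 * O.dist u m ≤
      ∑ i ∈ Finset.range (j + 1), a * O.radius i * (4 * M) := by
    refine Finset.sum_le_sum fun i hi => ?_
    have hi : i ≤ O.top := by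
      rw [Finset.mem_range] at hi
      omega
    have h1 : ∑ m ∈ O.contacted i u, 2 * O.dist u m ≤
        (O.contacted i u).card • (a * O.radius i * 4) :=
      Finset.sum_le_card_nsmul _ _ _ fun m hm => by
        linarith [dist_contacted_le hO hi hm]
    rw [nsmul_eq_mul] at h1
    have h2 : ((O.contacted i u).card : ℝ) ≤ M := by exact_mod_cast hO.card_contacted_le i hi u
    nlinarith [mul_le_mul_of_nonneg_right h2 (hr i)]
  have hnotify : ∑ i ∈ Finset.range j, (O.dist u (O.leader i u) +
      2 * O.dist (O.leader i u) (O.leaderBelow u i) +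
      O.dist (O.leader i u) (O.specialParent i u)) ≤
      ∑ i ∈ Finset.range j, a * O.radius i * (6 + b) := by
    refine Finset.sum_le_sum fun i hi => ?_
    have hi : i ≤ O.top := by
      rw [Finset.mem_range] at hi
      omega
    have h1 := hO.dist_leader_le i hi u
    have h2 := dist_leader_leaderBelow_le hO hi u
    have h3 := dist_specialParent_le hO hb hi u
    linarith
  have hsplit : ∑ i ∈ Finset.range (j + 1), a * O.radius i * (4 * M + 12 + b) =
      ∑ i ∈ Finset.range (j + 1), a * O.radius i * (4 * M) +
      (∑ i ∈ Finset.range j, a * O.radius i * (6 + b) + a * O.radius j * (6 + b)) +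
      (∑ i ∈ Finset.range j, a * O.radius i * 6 + a * O.radius j * 6) := by
    rw [← Finset.sum_range_succ, ← Finset.sum_range_succ, ← Finset.sum_add_distrib,
      ← Finset.sum_add_distrib]
    exact Finset.sum_congr rfl fun i _ => by ring
  have h6 : 0 ≤ ∑ i ∈ Finset.range j, a * O.radius i * 6 :=
    Finset.sum_nonneg fun i _ => mul_nonneg (hr i) (by norm_num)
  have h7 : 0 ≤ a * O.radius j * (6 + b) := mul_nonneg (hr j) (by positivity)
  linarith

/-- The amount by which the link of the directory path between the levels `k` and `k - 1` exceeds
the length `3 a r_k` that a link created by a move may have. -/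
noncomputable def excess (O : Overlay V) (a : ℝ) (d : PathState V) (k : ℕ) : ℝ :=
  max 0 (O.dist (O.node d k) (O.nodeBelow d k) - 3 * a * O.radius k)

/-- The total excess of the links of the directory path. -/
noncomputable def stretch (O : Overlay V) (a : ℝ) (d : PathState V) : ℝ :=
  ∑ k ∈ Finset.range (O.top + 1), O.excess a d k

/-- The link that enters the top level is short even if its lower end is arbitrary, so at most
`O.top` links have an excess. -/
lemma stretch_le (hO : O.IsSparseCover a M) (d : PathState V) :
    O.stretch a d ≤ O.top * O.diam := by
  have ha := zero_le_one.trans hO.one_le_scale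
  have htop : O.excess a d O.top = 0 := by
    refine max_eq_left ?_
    rw [node, hO.leader_top _ (O.nodeBelow d O.top), hO.dist_comm]
    have h1 := hO.dist_leader_le O.top le_rfl (O.nodeBelow d O.top)
    have h2 := mul_nonneg ha (hO.radius_nonneg O.top)
    linarith
  rw [stretch, Finset.sum_range_succ, htop, add_zero]
  have h : ∀ k ∈ Finset.range O.top, O.excess a d k ≤ O.diam := fun k _ =>
    max_le hO.diam_nonneg (by
      have h1 := hO.dist_le_diam (O.node d k) (O.nodeBelow d k)
      have h2 := mul_nonneg ha (hO.radius_nonneg k)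
      linarith)
  simpa using Finset.sum_le_card_nsmul _ _ _ h

lemma node_move_of_lt {d : PathState V} {u : V} {i : ℕ} (h : i < O.foundLevel d u) :
    O.node (O.move d u) i = O.leader i u := by
  simp [node, move, h]

lemma node_move_of_le {d : PathState V} {u : V} {i : ℕ} (h : O.foundLevel d u ≤ i) :
    O.node (O.move d u) i = O.node d i := by
  simp [node, move, not_lt.2 h]

lemma nodeBelow_move_of_le {d : PathState V} {u : V} {i : ℕ} (h : i ≤ O.foundLevel d u) :
    O.nodeBelow (O.move d u) i = O.leaderBelow u i := by
  cases i with
  | zero => rfl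
  | succ i => exact node_move_of_lt h

lemma nodeBelow_move_of_lt {d : PathState V} {u : V} {i : ℕ} (h : O.foundLevel d u < i) :
    O.nodeBelow (O.move d u) i = O.nodeBelow d i := by
  cases i with
  | zero => omega
  | succ i => exact node_move_of_le (Nat.lt_succ_iff.1 h)

lemma excess_move_of_le (hO : O.IsSparseCover a M) {d : PathState V} {u : V} {i : ℕ}
    (h : i ≤ O.foundLevel d u) : O.excess a (O.move d u) i = 0 := by
  have ha := zero_le_one.trans hO.one_le_scale
  have hr := mul_nonneg ha (hO.radius_nonneg i)
  refine max_eq_left ?_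
  rw [nodeBelow_move_of_le h]
  rcases h.lt_or_eq with hlt | rfl
  · rw [node_move_of_lt hlt]
    have := dist_leader_leaderBelow_le hO (h.trans (foundLevel_le_top hO d u)) u
    linarith
  · rw [node_move_of_le le_rfl]
    have := dist_node_leaderBelow_le hO d u
    linarith

lemma excess_move_of_lt {d : PathState V} {u : V} {i : ℕ} (h : O.foundLevel d u < i) :
    O.excess a (O.move d u) i = O.excess a d i := by
  rw [excess, excess, node_move_of_le h.le, nodeBelow_move_of_lt h]

/-- A move pays for the excess of the links it traverses, and replaces them by links without
excess. -/
lemma stretch_move (hO : O.IsSparseCover a M) (d : PathState V) (u : V) :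
    O.stretch a (O.move d u) + ∑ k ∈ Finset.range (O.foundLevel d u + 1), O.excess a d k =
      O.stretch a d := by
  have hj : O.foundLevel d u + 1 ≤ O.top + 1 := by
    have := foundLevel_le_top hO d u
    omega
  rw [stretch, stretch, ← Finset.sum_range_add_sum_Ico _ hj,
    ← Finset.sum_range_add_sum_Ico _ hj,
    Finset.sum_eq_zero (s := Finset.range (O.foundLevel d u + 1))
      fun k hk => excess_move_of_le hO (Nat.lt_succ_iff.1 (Finset.mem_range.1 hk)),
    Finset.sum_congr rfl fun k hk => excess_move_of_lt (Nat.lt_of_succ_le (Finset.mem_Ico.1 hk).1)]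
  ring

lemma downCost_le (hO : O.IsSparseCover a M) {b : ℝ} (hb : O.rho ^ O.offset ≤ b)
    (d : PathState V) (u : V) :
    O.downCost d u ≤ ∑ k ∈ Finset.range (O.foundLevel d u + 1), O.excess a d k +
      ∑ k ∈ Finset.range (O.foundLevel d u + 1), a * O.radius k * (4 + b) := by
  have ha := zero_le_one.trans hO.one_le_scale
  have hj := foundLevel_le_top hO d u
  have hb0 : 0 ≤ b := (pow_nonneg (zero_le_one.trans hO.one_lt_rho.le) _).trans hb
  have hr : ∀ i, 0 ≤ a * O.radius i := fun i => mul_nonneg ha (hO.radius_nonneg i)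
  unfold downCost
  set j := O.foundLevel d u
  have hlinks : ∑ k ∈ Finset.range (j + 1), O.dist (O.node d k) (O.nodeBelow d k) ≤
      ∑ k ∈ Finset.range (j + 1), O.excess a d k +
      ∑ k ∈ Finset.range (j + 1), a * O.radius k * 3 := by
    rw [← Finset.sum_add_distrib]
    refine Finset.sum_le_sum fun k _ => ?_
    have : O.dist (O.node d k) (O.nodeBelow d k) - 3 * a * O.radius k ≤ O.excess a d k :=
      le_max_right _ _
    linarith
  have hspecial : ∑ k ∈ Finset.range j, O.dist (O.node d k) (O.specialParent k (d.writer k)) ≤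
      ∑ k ∈ Finset.range j, a * O.radius k * (1 + b) := by
    refine Finset.sum_le_sum fun k hk => dist_specialParent_le hO hb ?_ (d.writer k)
    rw [Finset.mem_range] at hk
    omega
  have hsplit : ∑ k ∈ Finset.range (j + 1), a * O.radius k * (4 + b) =
      ∑ k ∈ Finset.range (j + 1), a * O.radius k * 3 +
      (∑ k ∈ Finset.range j, a * O.radius k * (1 + b) + a * O.radius j * (1 + b)) := by
    rw [← Finset.sum_range_succ, ← Finset.sum_add_distrib]
    exact Finset.sum_congr rfl fun i _ => by ring
  have h7 : 0 ≤ a * O.radius j * (1 + b) := mul_nonneg (hr j) (by positivity)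
  linarith

/-- Amortized cost of a move. Per level and in units of `a r_i`, the queries cost `4 M`, the
notifications `6 + b`, the link at the discovered level `6`, and the downward phase `4 + b`. -/
lemma moveCost_le (hO : O.IsSparseCover a M) {b : ℝ} (hb : O.rho ^ O.offset ≤ b)
    (d : PathState V) (u : V) :
    O.moveCost d u + O.stretch a (O.move d u) ≤ O.stretch a d + O.dist d.owner u +
      ∑ i ∈ Finset.range (O.top + 1), (if i ≤ O.foundLevel d u then 1 else 0) *
        (a * O.radius i * (4 * M + 16 + 2 * b)) := by
  have h1 := upCost_le hO hb d u
  have h2 := downCost_le hO hb d u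
  have h3 := stretch_move hO d u
  have hj := foundLevel_le_top hO d u
  have hfilter : (Finset.range (O.top + 1)).filter (· ≤ O.foundLevel d u) =
      Finset.range (O.foundLevel d u + 1) := by
    ext i
    simp only [Finset.mem_filter, Finset.mem_range]
    omega
  have h4 : ∑ i ∈ Finset.range (O.top + 1), (if i ≤ O.foundLevel d u then (1 : ℝ) else 0) *
        (a * O.radius i * (4 * M + 16 + 2 * b)) =
      ∑ i ∈ Finset.range (O.foundLevel d u + 1), a * O.radius i * (4 * M + 12 + b) +
      ∑ i ∈ Finset.range (O.foundLevel d u + 1), a * O.radius i * (4 + b) := by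
    simp only [ite_mul, one_mul, zero_mul]
    rw [← Finset.sum_filter, hfilter, ← Finset.sum_add_distrib]
    exact Finset.sum_congr rfl fun i _ => by ring
  rw [h4]
  unfold moveCost
  linarith

lemma totalCost_le_stretch (hO : O.IsSparseCover a M) {b : ℝ} (hb : O.rho ^ O.offset ≤ b)
    (d : PathState V) (S : List V) :
    O.totalCost d S ≤ O.stretch a d + O.optCost (d.owner :: S) +
      ∑ i ∈ Finset.range (O.top + 1), O.reachCount i d S *
        (a * O.radius i * (4 * M + 16 + 2 * b)) := by
  induction S generalizing d with
  | nil =>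
    have : 0 ≤ O.stretch a d := Finset.sum_nonneg fun k _ => le_max_left _ _
    simpa [totalCost, optCost, reachCount] using this
  | cons u S ih =>
    have h1 := moveCost_le hO hb d u
    have h2 := ih (O.move d u)
    simp only [totalCost, optCost, reachCount, Nat.cast_add, Nat.cast_ite, Nat.cast_one,
      Nat.cast_zero, add_mul, Finset.sum_add_distrib]
    have h3 : (O.move d u).owner = u := rfl
    rw [h3] at h2
    linarith

lemma totalCost_le (hO : O.IsSparseCover a M) {b : ℝ} (hb : O.rho ^ O.offset ≤ b)
    (d : PathState V) (S : List V) :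
    O.totalCost d S ≤ O.top * O.diam + O.optCost (d.owner :: S) +
      ∑ i ∈ Finset.range (O.top + 1), O.reachCount i d S *
        (a * O.radius i * (4 * M + 16 + 2 * b)) := by
  have h1 := totalCost_le_stretch hO hb d S
  have h2 := stretch_le hO d
  linarith

/-- A move that searches beyond level `i` is farther than `r_i` from the last earlier move that
did so, and then becomes the writer of level `i` itself. The distance of the owner from that
writer is the potential that telescopes these lower bounds. -/
lemma radius_mul_reachCount_le (hO : O.IsSparseCover a M) (i : ℕ) (d : PathState V)
    (S : List V) :
    O.radius i * O.reachCount (i + 1) d S ≤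
      O.optCost (d.owner :: S) + O.dist (d.writer i) d.owner := by
  induction S generalizing d with
  | nil => simpa [optCost, reachCount] using hO.dist_nonneg _ _
  | cons u S ih =>
    have h1 := ih (O.move d u)
    have h2 := hO.dist_triangle (d.writer i) d.owner u
    have h3 : (O.move d u).owner = u := rfl
    rw [h3] at h1
    simp only [optCost, reachCount, Nat.cast_add, Nat.cast_ite, Nat.cast_one, Nat.cast_zero]
    by_cases h : i + 1 ≤ O.foundLevel d u
    · have h4 := radius_lt_of_lt_foundLevel (O := O) h
      have h5 : (O.move d u).writer i = u := if_pos h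
      rw [h5, hO.dist_self] at h1
      rw [hO.dist_comm] at h4
      rw [if_pos h]
      linarith
    · have h5 : (O.move d u).writer i = d.writer i := if_neg h
      rw [h5] at h1
      rw [if_neg h]
      linarith

lemma reachCount_zero (d : PathState V) (S : List V) : O.reachCount 0 d S = S.length := by
  induction S generalizing d with
  | nil => rfl
  | cons u S ih => simp [reachCount, ih, add_comm]

lemma length_le_optCost (hO : O.IsSparseCover a M) {S : List V} (hS : S.IsChain (· ≠ ·)) :
    (S.length : ℝ) ≤ O.optCost S + 1 := by
  induction S with
  | nil => simp [optCost]
  | cons u S ih =>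
    cases S with
    | nil => simp [optCost]
    | cons v S =>
      have h1 := hO.one_le_dist u v (List.isChain_cons_cons.1 hS).1
      have h2 := ih (List.isChain_cons_cons.1 hS).2
      simp only [List.length_cons, Nat.cast_add, Nat.cast_one, optCost] at h2 ⊢
      linarith

/-- In a sequence of optimal cost at least the diameter, every level costs only a constant
multiple of `ρ` times the optimal cost. -/
lemma reachCount_mul_radius_le (hO : O.IsSparseCover a M) (hdiam : 1 ≤ O.diam)
    {d : PathState V} {S : List V} (hS : S.IsChain (· ≠ ·)) (hopt : O.diam ≤ O.optCost S)
    (howner : O.optCost (d.owner :: S) ≤ O.diam + O.optCost S) (i : ℕ) :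
    O.reachCount i d S * O.radius i ≤ 3 * O.rho * O.optCost S := by
  have hρ := hO.one_lt_rho
  cases i with
  | zero =>
    have h1 : O.radius 0 ≤ 1 := (min_le_right _ _).trans_eq (pow_zero _)
    have h2 := length_le_optCost hO hS
    rw [reachCount_zero]
    have h3 : (S.length : ℝ) * O.radius 0 ≤ S.length :=
      mul_le_of_le_one_right (Nat.cast_nonneg _) h1
    nlinarith
  | succ i =>
    have h1 := radius_mul_reachCount_le hO i d S
    have h2 := hO.dist_le_diam (d.writer i) d.owner
    have h3 := hO.radius_add_le i 1
    rw [pow_one] at h3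
    have h4 : O.radius i * O.reachCount (i + 1) d S ≤ 3 * O.optCost S := by linarith
    calc (O.reachCount (i + 1) d S : ℝ) * O.radius (i + 1)
        ≤ O.reachCount (i + 1) d S * (O.rho * O.radius i) :=
          mul_le_mul_of_nonneg_left h3 (Nat.cast_nonneg _)
      _ = O.rho * (O.radius i * O.reachCount (i + 1) d S) := by ring
      _ ≤ O.rho * (3 * O.optCost S) := mul_le_mul_of_nonneg_left h4 (by linarith)
      _ = _ := by ring

lemma optCost_cons_le (hO : O.IsSparseCover a M) (x : V) {S : List V} :
    O.optCost (x :: S) ≤ O.diam + O.optCost S := by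
  cases S with
  | nil => simpa [optCost] using hO.diam_nonneg
  | cons v S => simpa [optCost] using hO.dist_le_diam x v

/-- For a long sequence the fixed costs, which are bounded in terms of the diameter, are
dominated by the optimal cost. -/
lemma totalCost_le_mul_optCost (hO : O.IsSparseCover a M) (hdiam : 1 ≤ O.diam)
    {d : PathState V} {S : List V} (hS : S.IsChain (· ≠ ·)) {B : ℝ} (hB : 1 ≤ B)
    (hcost : O.totalCost d S ≤ O.top * O.diam + O.optCost (d.owner :: S) +
      ∑ i ∈ Finset.range (O.top + 1), O.reachCount i d S * (O.radius i * B))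
    (hlong : 2 * ((max 1 O.top : ℕ) : ℝ) ^ 2 * O.diam ≤ S.length) :
    O.totalCost d S ≤ 9 * (max 1 O.top : ℕ) * O.rho * B * O.optCost S := by
  have hL : (1 : ℝ) ≤ (max 1 O.top : ℕ) := by exact_mod_cast le_max_left _ _
  have htop : (O.top : ℝ) ≤ (max 1 O.top : ℕ) := by exact_mod_cast le_max_right _ _
  set L : ℝ := ((max 1 O.top : ℕ) : ℝ)
  have hρ := hO.one_lt_rho
  have hlen := length_le_optCost hO hS
  have hopt : O.diam ≤ O.optCost S := by nlinarith [one_le_pow₀ hL (n := 2)]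
  set C := O.optCost S
  have howner : O.optCost (d.owner :: S) ≤ O.diam + C := optCost_cons_le hO d.owner
  have hC : 1 ≤ C := hdiam.trans hopt
  have hsum : ∑ i ∈ Finset.range (O.top + 1), O.reachCount i d S * (O.radius i * B) ≤
      (O.top + 1 : ℕ) * (3 * O.rho * C * B) := by
    have := Finset.sum_le_card_nsmul (Finset.range (O.top + 1))
      (fun i => O.reachCount i d S * (O.radius i * B)) (3 * O.rho * C * B) fun i _ => by
        have := mul_le_mul_of_nonneg_right
          (reachCount_mul_radius_le hO hdiam hS hopt howner i) (zero_le_one.trans hB)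
        linarith
    simpa using this
  push_cast at hsum
  have hρB : 1 ≤ O.rho * B := by nlinarith
  have hX : L * C ≤ L * C * (O.rho * B) := le_mul_of_one_le_right (by positivity) hρB
  have h1 : (O.top : ℝ) * O.diam ≤ L * C :=
    mul_le_mul htop hopt hO.diam_nonneg (by linarith)
  have h2 : C ≤ L * C := le_mul_of_one_le_left (by linarith) hL
  have h3 : ((O.top : ℝ) + 1) * (3 * O.rho * C * B) ≤ 2 * L * (3 * O.rho * C * B) :=
    mul_le_mul_of_nonneg_right (by linarith) (by positivity)
  linarith

end Overlay

end FaultyDirectory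
namespace FaultyDirectory

/-! ### The repaired overlay is a sparse cover -/

section Cover

variable {V : Type*} [Fintype V] {G : SimpleGraph V} {w : Sym2 V → ℝ} {ρ σ κ : ℝ} {I : ℕ}
  {F : List (Sym2 V)} {T : ℕ → V → V}

/-- Every level arises by cutting the failed edges in a shortest path forest of one of the
intermediate graphs. Its depth is within the level radius of the final graph, up to the factor
`κ σ`, and every ball of the final graph meets at most `I` of its trees. -/
lemma exists_forest_of_level [Nontrivial V] (hw : ∀ e ∈ G.edgeSet, 1 ≤ w e) (hρ : 1 < ρ)
    (hσ : 1 ≤ σ) (hκ : 1 ≤ κ) (P : Hierarchy G w ρ σ I)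
    (hconn : (afterFailures G F F.length).Connected) (hT : IsRootTrees P F T) (i : ℕ) :
    ∃ t l, IsShortestPathForest (afterFailures G F t) w l (levelTrees P κ F T i) ∧
      (∀ x, depth (afterFailures G F t) w l x ≤
        κ * σ * rad (afterFailures G F F.length) w ρ i) ∧
      ∀ u, (l '' wball (afterFailures G F F.length) w u
        (rad (afterFailures G F F.length) w ρ i)).ncard ≤ I := by
  have hσ0 := zero_lt_one.trans_le hσ
  set G' := afterFailures G F F.length
  have hw' : ∀ e ∈ G'.edgeSet, 1 ≤ w e := edge_weight_of_le hw (afterFailures_le _)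
  have hκσ : σ ≤ κ * σ := le_mul_of_one_le_left hσ0.le hκ
  have hdiam : wdiam G w ≤ wdiam G' w := wdiam_anti hw (afterFailures_le _) hconn
  by_cases hi : i < height G w ρ
  · refine ⟨0, P.leader i, ?_, ?_, ?_⟩
    · rw [afterFailures_zero, levelTrees, if_pos hi]
      exact P.tree i hi.le
    · intro x
      rw [afterFailures_zero]
      have h1 := ((P.sparse i hi.le).strong_diam (P.leader i x) x
        ((P.sparse i hi.le).leader_mem x)).2
      have h2 : rad G w ρ i ≤ rad G' w ρ i := min_le_min_right _ hdiam
      have h3 := rad_nonneg hw' hρ i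
      unfold depth
      nlinarith
    · intro u
      refine (Set.ncard_le_ncard (Set.image_mono fun x hx => ?_)).trans
        ((P.sparse i hi.le).sparse u)
      rw [wball, Set.mem_ofPred_eq] at hx ⊢
      -- Distances in `G` never exceed its diameter, so only the bound `ρ ^ i` matters.
      exact le_min (wdist_le_wdiam u x) ((wdist_anti hw (afterFailures_le _)
        (hconn.preconnected u x)).trans (hx.trans (min_le_right _ _)))
  · obtain ⟨t, ht, hlevel, htree⟩ := levelTrees_of_height_le (κ := κ) (F := F) P
      (T := T) (not_lt.1 hi)
    refine ⟨t, fun _ => P.root, ?_, ?_, ?_⟩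
    · rw [htree]
      exact hT.spt t ht
    · intro x
      rw [depth, clusterGraph_const, rad, mul_min_of_nonneg _ _ (by positivity)]
      refine le_min ?_ ?_
      · have h1 : wdist (afterFailures G F t) w P.root x ≤ wdiam G' w :=
          (wdist_anti (edge_weight_of_le hw (afterFailures_le _))
            (afterFailures_length_le t) (hconn.preconnected _ _)).trans (wdist_le_wdiam _ _)
        exact h1.trans (le_mul_of_one_le_left (wdiam_nonneg hw') (hσ.trans hκσ))
      · refine (wdist_root_le P hw hρ hσ0 hκ t x).trans ?_
        exact mul_le_mul_of_nonneg_left (pow_le_pow_right₀ hρ.le hlevel) (by positivity)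
    · intro u
      refine le_trans ?_ (P.one_le_sparsity hw hρ)
      refine (Set.ncard_le_ncard (t := {P.root}) ?_).trans (Set.ncard_singleton _).le
      rintro _ ⟨x, -, rfl⟩
      rfl

/-- The top level of the repaired overlay uses the tree of the final graph, in which no edge is
cut. -/
lemma cutLeader_topLevel (hw : ∀ e ∈ G.edgeSet, 1 ≤ w e) (hρ : 1 < ρ) (hσ : 0 < σ)
    (hκ : 1 ≤ κ) (P : Hierarchy G w ρ σ I) (hT : IsRootTrees P F T) (x : V) :
    cutLeader F (levelTrees P κ F T (topLevel G w ρ σ κ P.root F F.length)) x = P.root := by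
  have htree : levelTrees P κ F T (topLevel G w ρ σ κ P.root F F.length) = T F.length := by
    rw [levelTrees, if_neg (not_lt.2 (height_le_topLevel hρ hσ hκ P.root F.length))]
    congr 1
    exact le_antisymm (Nat.findGreatest_le _)
      (Nat.le_findGreatest (P := fun t => topLevel G w ρ σ κ P.root F t ≤ _) le_rfl le_rfl)
  have hF := hT.spt F.length le_rfl
  rw [htree]
  by_contra hne
  have hadj := (hF.step _ (Ne.symm hne)).1.1
  have hfix := cutParent_cutLeader (edge_weight_of_le hw (afterFailures_le _)) hF F x
  rw [cutParent, if_neg (afterFailures_length_adj.1 hadj).2] at hfix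
  exact hadj.ne hfix.symm

lemma isSparseCover_repaired [Nontrivial V] (hw : ∀ e ∈ G.edgeSet, 1 ≤ w e) (hρ : 1 < ρ)
    (hσ : 1 ≤ σ) (hκ : 1 ≤ κ) (P : Hierarchy G w ρ σ I)
    (hconn : (afterFailures G F F.length).Connected) (hT : IsRootTrees P F T) (s : ℕ) :
    (repaired P κ F T s).IsSparseCover (κ * σ) (I + F.length) := by
  have hw' : ∀ e ∈ (afterFailures G F F.length).edgeSet, 1 ≤ w e :=
    edge_weight_of_le hw (afterFailures_le _)
  refine
    { dist_self := wdist_self hw'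
      dist_comm := wdist_comm
      dist_triangle := wdist_triangle hw' hconn
      one_le_dist := fun x y => one_le_wdist hw' (hconn.preconnected x y)
      dist_le_diam := wdist_le_wdiam
      diam_nonneg := wdiam_nonneg hw'
      one_lt_rho := hρ
      radius_nonneg := rad_nonneg hw' hρ
      radius_add_le := rad_add_le hw' hρ
      one_le_scale := by nlinarith
      dist_leader_le := fun i _ x => ?_
      card_contacted_le := fun i _ u => ?_
      leader_top := fun x y =>
        (cutLeader_topLevel hw hρ (zero_lt_one.trans_le hσ) hκ P hT x).trans
          (cutLeader_topLevel hw hρ (zero_lt_one.trans_le hσ) hκ P hT y).symm }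
  · obtain ⟨t, l, hl, hdepth, -⟩ := exists_forest_of_level hw hρ hσ hκ P hconn hT i
    refine (wdist_cutLeader_le (edge_weight_of_le hw (afterFailures_le _))
      (afterFailures_length_le t) hconn hl (fun x y hxy hF => ?_) x).trans (hdepth x)
    exact afterFailures_length_adj.2 ⟨afterFailures_le _ hxy, hF⟩
  · obtain ⟨t, l, hl, -, hsparse⟩ := exists_forest_of_level hw hρ hσ hκ P hconn hT i
    have h1 := (ncard_cutLeader_image_le (edge_weight_of_le hw (afterFailures_le _)) hl F
      (wball (afterFailures G F F.length) w u
        (rad (afterFailures G F F.length) w ρ i))).trans (Nat.add_le_add_right (hsparse u) _)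
    have hset : ((repaired P κ F T s).contacted i u : Set V) =
        cutLeader F (levelTrees P κ F T i) '' wball (afterFailures G F F.length) w u
          (rad (afterFailures G F F.length) w ρ i) := by
      ext m
      simp only [Overlay.contacted, Finset.mem_coe, Finset.mem_image, Finset.mem_filter,
        Finset.mem_univ, true_and]
      rfl
    rw [← Set.ncard_coe_finset, hset]
    exact h1

end Cover

end FaultyDirectory

theorem mainTheorem3 (c κ : ℝ) (hc : 0 < c) (hκ : 1 ≤ κ) :
    ∃ K N : ℝ, 0 < K ∧ 0 < N ∧
      ∀ (V : Type*) [Fintype V] (G : SimpleGraph V) (w : Sym2 V → ℝ)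
        (_ : ∀ e ∈ G.edgeSet, 1 ≤ w e)
        (ρ σ : ℝ) (_ : 1 < ρ) (I : ℕ)
        (P : FaultyDirectory.Hierarchy G w ρ σ I)
        (F : List (Sym2 V)) (_ : F.Nodup) (_ : ∀ e ∈ F, e ∈ G.edgeSet)
        (_ : (FaultyDirectory.afterFailures G F F.length).Connected)
        (T : ℕ → V → V) (_ : FaultyDirectory.IsRootTrees P F T)
        (s : ℕ) (_ : ρ ^ s ≤ c * σ)
        (d : FaultyDirectory.PathState V) (S : List V)
        (_ : (d.owner :: S).IsChain (· ≠ ·)),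
        let O := FaultyDirectory.repaired P κ F T s
        let f : ℕ := F.length
        (N * (max 1 O.top : ℕ) ^ 2 * O.diam ≤ S.length →
          O.totalCost d S ≤
            K * ((max 1 O.top : ℕ) * σ * ρ * ((I + f) + σ)) * O.optCost S) ∧
        O.totalCost d S ≤
          O.top * O.diam + O.optCost (d.owner :: S) +
            K * ∑ i ∈ Finset.range (O.top + 1),
              O.reachCount i d S * (σ * O.radius i * ((I + f) + σ)) := by
  have hK : 1 ≤ κ * (16 + 2 * c) := by nlinarith
  -- The second claim holds with the constant `κ (16 + 2 c)`; the factor `9` comes from comparing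
  -- the sum over the levels with the optimal cost.
  refine ⟨9 * (κ * (16 + 2 * c)), 2, by linarith, two_pos, ?_⟩
  intro V _ G w hw ρ σ hρ I P F _ _ hconn T hT s hs d S hS O f
  have hw' : ∀ e ∈ O.graph.edgeSet, 1 ≤ w e :=
    FaultyDirectory.edge_weight_of_le hw (FaultyDirectory.afterFailures_le _)
  have hσ : 0 < σ := by
    have : 0 < ρ ^ s := by positivity
    exact pos_of_mul_pos_right (this.trans_le hs) hc.le
  rcases subsingleton_or_nontrivial V with hV | hV
  · -- On a single vertex no move is possible.
    obtain rfl : S = [] := by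
      cases S with
      | nil => rfl
      | cons u S => exact absurd (Subsingleton.elim _ _) (List.isChain_cons_cons.1 hS).1
    have h1 : 0 ≤ O.top * O.diam :=
      mul_nonneg (Nat.cast_nonneg _) (FaultyDirectory.wdiam_nonneg hw')
    simpa [FaultyDirectory.Overlay.totalCost, FaultyDirectory.Overlay.optCost,
      FaultyDirectory.Overlay.reachCount] using h1
  have hG : G.Connected := hconn.mono (FaultyDirectory.afterFailures_le _)
  have hσ1 : 1 ≤ σ := P.one_le_stretch hw hG hσ
  have hO := FaultyDirectory.isSparseCover_repaired hw hρ hσ1 hκ P hconn hT s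
  change O.IsSparseCover _ _ at hO
  have hM : (0 : ℝ) ≤ (I : ℝ) + f := by positivity
  set B : ℝ := κ * (16 + 2 * c) * (σ * ((I + f) + σ)) with hB
  have hB1 : 1 ≤ B := one_le_mul_of_one_le_of_one_le hK (by nlinarith)
  have hcost : O.totalCost d S ≤ O.top * O.diam + O.optCost (d.owner :: S) +
      ∑ i ∈ Finset.range (O.top + 1), O.reachCount i d S * (O.radius i * B) := by
    refine (FaultyDirectory.Overlay.totalCost_le hO hs d S).trans ?_
    refine add_le_add_right (Finset.sum_le_sum fun i _ =>
      mul_le_mul_of_nonneg_left ?_ (Nat.cast_nonneg _)) _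
    have h1 : 4 * ((I + F.length : ℕ) : ℝ) + 16 + 2 * (c * σ) ≤
        (16 + 2 * c) * ((I + f) + σ) := by
      push_cast
      change 4 * ((I : ℝ) + f) + 16 + 2 * (c * σ) ≤ _
      nlinarith [mul_nonneg hc.le hM]
    have h2 : 0 ≤ κ * σ * O.radius i :=
      mul_nonneg (by positivity) (hO.radius_nonneg i)
    calc _ ≤ κ * σ * O.radius i * ((16 + 2 * c) * ((I + f) + σ)) :=
          mul_le_mul_of_nonneg_left h1 h2
      _ = _ := by rw [hB]; ring
  constructor
  · intro hlong
    obtain ⟨x, y, hxy⟩ := exists_pair_ne V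
    have hdiam : 1 ≤ O.diam := (hO.one_le_dist x y hxy).trans (hO.dist_le_diam x y)
    refine (FaultyDirectory.Overlay.totalCost_le_mul_optCost hO hdiam hS.of_cons hB1 hcost
      hlong).trans_eq ?_
    change 9 * _ * ρ * B * _ = _
    rw [hB]
    ring
  · refine hcost.trans (add_le_add_right ?_ _)
    rw [Finset.mul_sum]
    refine Finset.sum_le_sum fun i _ => ?_
    have h1 : 0 ≤ O.reachCount i d S * (O.radius i * B) :=
      mul_nonneg (Nat.cast_nonneg _)
        (mul_nonneg (hO.radius_nonneg i) (zero_le_one.trans hB1))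
    calc _ ≤ 9 * (O.reachCount i d S * (O.radius i * B)) := by linarith
      _ = _ := by rw [hB]; ring
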